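/- Let $p$ be an odd prime, let $\bar k$ be an algebraically closed field of characteristic different from $p$ and let $E/\bar k$ be an elliptic curve. Fix a generator $\gamma$ of $\mathbb{F}_{p^2}^\times$, and let $\mathcal C_\gamma\subset \mathrm{PGL}(E[p])$ be the conjugacy class of the elements having a representative in $\mathrm{GL}(E[p])$ whose characteristic polynomial is the minimal polynomial of $\gamma$ over $\mathbb{F}_p$. An oriented necklace is a list $(C_0,C_1,\dots,C_p)$ of all the cyclic subgroups of order $p$ of $E[p]$, without repetition and taken up to cyclic permutation, such that some $h\in\mathcal C_\gamma$ satisfies $h(C_i)=C_{i+1}$ for $i=0,\dots,p-1$. A necklace is an orbit of the involution $(C_0,C_1,\dots,C_p)\mapsto(C_p,\dots,C_1,C_0)$ on oriented necklaces. The group $\mathrm{PGL}(E[p])$ acts on necklaces by $g\cdot(C_0,\dots,C_p)=(g(C_0),\dots,g(C_p))$. Two subgroups $C_i$, $C_j$ are antipodal in a necklace represented by $(C_0,\dots,C_p)$ if $i\equiv j+\frac{p+1}{2} \pmod{p+1}$. For necklaces $\mathfrak v$, $\mathfrak w$ let $\langle\mathfrak v,\mathfrak w\rangle$ be the number of unordered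 pairs $\{A,B\}$ such that $A$ and $B$ are antipodal in $\mathfrak v$ and in $\mathfrak w$, and extend $\langle\cdot,\cdot\rangle$ bilinearly to the free abelian group $\bigoplus_{\mathfrak v}\mathbb{Z}\,\mathfrak v$ on the set of necklaces, on which $\mathrm{PGL}(E[p])$ acts by permuting the basis. Then $\langle\cdot,\cdot\rangle$ is a symmetric bilinear form on $\bigoplus_{\mathfrak v}\mathbb{Z}\,\mathfrak v$ which is positive ($\langle u,u\rangle\ge 0$ for all $u$), non-degenerate (if $\langle u,u'\rangle=0$ for all $u'$, then $u=0$) and $\mathrm{PGL}(E[p])$-equivariant ($\langle gu,gu'\rangle=\langle u,u'\rangle$ for all $g$, $u$, $u'$). Moreover $\langle\mathfrak v,\mathfrak v\rangle=\frac{p+1}{2}$ for every necklace $\mathfrak v$, and $\langle\mathfrak v,\mathfrak w\rangle\in\{0,1\}$ for all necklaces $\mathfrak v\ne\mathfrak w$. -/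

import Mathlib

open scoped LinearAlgebra.Projectivization

namespace Necklace

noncomputable section

section ProjectiveLinearGroup

variable (K : Type*) [Field K] (V : Type*) [AddCommGroup V] [Module K V]

/-- The subgroup `K^×` of scalar maps in `GL(V)`. -/
def scalars : Subgroup (LinearMap.GeneralLinearGroup K V) :=
  (Units.map (algebraMap K (Module.End K V)).toMonoidHom).range

instance scalars_normal : (scalars K V).Normal where
  conj_mem := by
    rintro _ ⟨c, rfl⟩ g
    refine ⟨c, ?_⟩
    have : Units.map (algebraMap K (Module.End K V)).toMonoidHom c * g
        = g * Units.map (algebraMap K (Module.End K V)).toMonoidHom c := by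
      ext v
      simp [Module.algebraMap_end_apply]
    rw [← this, mul_inv_cancel_right]

/-- `PGL(V) = GL(V) / K^×`. -/
abbrev PGL : Type _ := LinearMap.GeneralLinearGroup K V ⧸ scalars K V

/-- The action of `PGL(V)` on the lines of `V`, as a homomorphism to permutations, induced by
the natural action of `GL(V)`. -/
def PGL.toPerm : PGL K V →* Equiv.Perm (ℙ K V) :=
  QuotientGroup.lift (scalars K V)
    (MulAction.toPermHom (LinearMap.GeneralLinearGroup K V) (ℙ K V)) (by
      rintro _ ⟨c, rfl⟩
      ext x
      induction x using Projectivization.ind with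
      | h v hv =>
        change (Units.map (algebraMap K (Module.End K V)).toMonoidHom c) •
          Projectivization.mk K v hv = Projectivization.mk K v hv
        rw [Projectivization.smul_mk, Projectivization.mk_eq_mk_iff]
        exact ⟨c, rfl⟩)

instance PGL.mulAction : MulAction (PGL K V) (ℙ K V) :=
  MulAction.compHom _ (PGL.toPerm K V)

theorem PGL.mk_smul (g : LinearMap.GeneralLinearGroup K V) (x : ℙ K V) :
    (QuotientGroup.mk g : PGL K V) • x = g • x := rfl

end ProjectiveLinearGroup

variable {p : ℕ} [Fact p.Prime]

/-- The conjugacy class `𝒞_γ` in `PGL(V)`, for a two-dimensional `𝔽_p`-vector space `V`: the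
elements `h` that have a representative `g` in `GL(V)` whose characteristic polynomial (that of
the matrix of `g` in a basis of `V`) is the minimal polynomial of `γ` over `𝔽_p`. -/
def conjClass (γ : (GaloisField p 2)ˣ) (V : Type*) [AddCommGroup V] [Module (ZMod p) V] :
    Set (PGL (ZMod p) V) :=
  {h | ∃ g : LinearMap.GeneralLinearGroup (ZMod p) V, QuotientGroup.mk g = h ∧
    ∃ b : Module.Basis (Fin 2) (ZMod p) V,
      (LinearMap.toMatrix b b (g : V →ₗ[ZMod p] V)).charpoly
        = minpoly (ZMod p) (γ : GaloisField p 2)}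

variable (γ : (GaloisField p 2)ˣ) (V : Type*) [AddCommGroup V] [Module (ZMod p) V]

variable {γ V} in
theorem conj_mem_conjClass {h : PGL (ZMod p) V} (hh : h ∈ conjClass γ V) (k : PGL (ZMod p) V) :
    k * h * k⁻¹ ∈ conjClass γ V := by
  obtain ⟨g, rfl, b, hb⟩ := hh
  obtain ⟨k, rfl⟩ := QuotientGroup.mk_surjective k
  refine ⟨k * g * k⁻¹, rfl, b.map k.toLinearEquiv, ?_⟩
  rw [← hb]
  congr 1
  ext i j
  simp only [LinearMap.toMatrix_apply, Module.Basis.map_apply, Module.Basis.map_repr,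
    LinearEquiv.trans_apply]
  have h1 : ((k * g * k⁻¹ : LinearMap.GeneralLinearGroup (ZMod p) V) : V →ₗ[ZMod p] V)
      (k.toLinearEquiv (b j)) = k.toLinearEquiv ((g : V →ₗ[ZMod p] V) (b j)) := by
    have h2 : (k * g * k⁻¹) * k = k * g := by group
    exact LinearMap.congr_fun (congrArg Units.val h2) (b j)
  rw [h1, LinearEquiv.symm_apply_apply]

variable {γ V} in
theorem inv_mem_conjClass {h : PGL (ZMod p) V} (hh : h ∈ conjClass γ V) :
    h⁻¹ ∈ conjClass γ V := by
  obtain ⟨g, rfl, b, hb⟩ := hh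
  set M := LinearMap.toMatrix b b (g : V →ₗ[ZMod p] V) with hM
  set N := LinearMap.toMatrix b b ((g⁻¹ : LinearMap.GeneralLinearGroup (ZMod p) V) :
    V →ₗ[ZMod p] V) with hN
  have hMN : M * N = 1 := by
    rw [hM, hN, ← LinearMap.toMatrix_mul, ← Units.val_mul, mul_inv_cancel, Units.val_one,
      LinearMap.toMatrix_one]
  have hdet : M.det ≠ 0 := by
    intro h0
    have := congrArg Matrix.det hMN
    rw [Matrix.det_mul, h0, zero_mul, Matrix.det_one] at this
    exact zero_ne_one this
  have hadj : M.adjugate = M.det • N := by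
    calc M.adjugate = M.adjugate * (M * N) := by rw [hMN, mul_one]
      _ = M.det • N := by rw [← mul_assoc, Matrix.adjugate_mul, Matrix.smul_mul, one_mul]
  refine ⟨Units.map (algebraMap (ZMod p) (Module.End (ZMod p) V)).toMonoidHom
    (Units.mk0 _ hdet) * g⁻¹, ?_, b, ?_⟩
  · rw [QuotientGroup.mk_mul, QuotientGroup.mk_inv]
    have : (QuotientGroup.mk (Units.map (algebraMap (ZMod p) (Module.End (ZMod p) V)).toMonoidHom
        (Units.mk0 _ hdet)) : PGL (ZMod p) V) = 1 :=
      (QuotientGroup.eq_one_iff _).2 ⟨_, rfl⟩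
    rw [this, one_mul]
  · have h1 : LinearMap.toMatrix b b
        ((Units.map (algebraMap (ZMod p) (Module.End (ZMod p) V)).toMonoidHom
          (Units.mk0 _ hdet) * g⁻¹ : LinearMap.GeneralLinearGroup (ZMod p) V) :
          V →ₗ[ZMod p] V) = M.adjugate := by
      rw [hadj, hN, ← map_smul]
      rfl
    rw [h1, ← hb, Matrix.charpoly_fin_two, Matrix.charpoly_fin_two]
    simp [Matrix.adjugate_fin_two, Matrix.trace_fin_two, Matrix.det_fin_two]
    ring

/-- A list `(C_0, …, C_p)` of all the lines of `V`, indexed by `ℤ/(p+1)`, without repetitions,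
for which some `h ∈ 𝒞_γ` satisfies `h(C_i) = C_{i+1}` (for `i = p`, `h(C_p) = C_0` is automatic). -/
@[ext]
structure Labelling where
  pearl : ZMod (p + 1) → ℙ (ZMod p) V
  bijective : Function.Bijective pearl
  exists_turn : ∃ h ∈ conjClass γ V, ∀ i, h • pearl i = pearl (i + 1)

variable {γ V}

instance Labelling.mulAction : MulAction (PGL (ZMod p) V) (Labelling γ V) where
  smul g C :=
    { pearl := fun i => g • C.pearl i
      bijective := (MulAction.bijective g).comp C.bijective
      exists_turn := by
        obtain ⟨h, hh, hC⟩ := C.exists_turn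
        refine ⟨g * h * g⁻¹, conj_mem_conjClass hh g, fun i => ?_⟩
        rw [← hC i, mul_smul, mul_smul, inv_smul_smul] }
  one_smul C := Labelling.ext (funext fun i => one_smul _ (C.pearl i))
  mul_smul g g' C := Labelling.ext (funext fun i => mul_smul g g' (C.pearl i))

/-- The list `(C_p, C_{p-1}, …, C_0)`. -/
def Labelling.reverse (C : Labelling γ V) : Labelling γ V where
  pearl i := C.pearl (-1 - i)
  bijective := C.bijective.comp (Equiv.subLeft (-1 : ZMod (p + 1))).bijective
  exists_turn := by
    obtain ⟨h, hh, hC⟩ := C.exists_turn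
    refine ⟨h⁻¹, inv_mem_conjClass hh, fun i => ?_⟩
    rw [inv_smul_eq_iff, hC]
    exact congrArg C.pearl (by ring)

variable (γ V)

/-- Two lists are equivalent if they differ by a cyclic permutation. -/
instance Labelling.setoid : Setoid (Labelling γ V) where
  r C C' := ∃ k : ZMod (p + 1), ∀ i, C'.pearl i = C.pearl (i + k)
  iseqv := by
    refine ⟨fun C => ⟨0, fun i => by rw [add_zero]⟩, ?_, ?_⟩
    · rintro C C' ⟨k, hk⟩
      exact ⟨-k, fun i => by rw [hk, neg_add_cancel_right]⟩
    · rintro C C' C'' ⟨k, hk⟩ ⟨l, hl⟩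
      exact ⟨l + k, fun i => by rw [hl, hk, add_assoc]⟩

/-- Oriented `γ`-necklaces of `V`. -/
def OrientedNecklace : Type _ := Quotient (Labelling.setoid γ V)

variable {γ V}

/-- The oriented necklace `(C_0, …, C_p)`. -/
def Labelling.toOriented (C : Labelling γ V) : OrientedNecklace γ V :=
  Quotient.mk (Labelling.setoid γ V) C

instance OrientedNecklace.mulAction :
    MulAction (PGL (ZMod p) V) (OrientedNecklace γ V) where
  smul g := Quotient.map (fun C => g • C) (by
    rintro C C' ⟨k, hk⟩
    exact ⟨k, fun i => congrArg (g • ·) (hk i)⟩)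
  one_smul v := by
    induction v using Quotient.ind with
    | _ C => exact congrArg Labelling.toOriented (one_smul _ C)
  mul_smul g g' v := by
    induction v using Quotient.ind with
    | _ C => exact congrArg Labelling.toOriented (mul_smul g g' C)

/-- The involution `w (C_0, …, C_p) = (C_p, …, C_0)` changing the orientation. -/
def OrientedNecklace.w : OrientedNecklace γ V → OrientedNecklace γ V :=
  Quotient.map Labelling.reverse (by
    rintro C C' ⟨k, hk⟩
    refine ⟨-k, fun i => ?_⟩
    change C'.pearl (-1 - i) = C.pearl (-1 - (i + -k))
    rw [hk]
    exact congrArg C.pearl (by ring))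

theorem OrientedNecklace.w_w (v : OrientedNecklace γ V) : v.w.w = v := by
  induction v using Quotient.ind with
  | _ C =>
    refine congrArg Labelling.toOriented (Labelling.ext (funext fun i => ?_))
    change C.pearl (-1 - (-1 - i)) = C.pearl i
    exact congrArg C.pearl (by ring)

theorem OrientedNecklace.smul_w (g : PGL (ZMod p) V) (v : OrientedNecklace γ V) :
    g • v.w = (g • v).w := by
  induction v using Quotient.ind with
  | _ C => rfl

variable (γ V)

/-- Two oriented necklaces are related if they lie in the same `w`-orbit `{v, w(v)}`. -/
instance OrientedNecklace.setoid : Setoid (OrientedNecklace γ V) where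
  r v v' := v' = v ∨ v' = v.w
  iseqv := by
    refine ⟨fun v => Or.inl rfl, ?_, ?_⟩
    · rintro v v' (rfl | rfl)
      · exact Or.inl rfl
      · exact Or.inr v.w_w.symm
    · rintro v v' v'' (rfl | rfl) (rfl | rfl)
      · exact Or.inl rfl
      · exact Or.inr rfl
      · exact Or.inr rfl
      · exact Or.inl v.w_w

end

end Necklace

open Necklace in
/-- `γ`-necklaces of `V`: the `w`-orbits of oriented `γ`-necklaces. -/
def Necklace {p : ℕ} [Fact p.Prime] (γ : (GaloisField p 2)ˣ) (V : Type*) [AddCommGroup V]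
    [Module (ZMod p) V] : Type _ :=
  Quotient (OrientedNecklace.setoid γ V)

namespace Necklace

noncomputable section

variable {p : ℕ} [Fact p.Prime] {γ : (GaloisField p 2)ˣ} {V : Type*} [AddCommGroup V]
  [Module (ZMod p) V]

/-- The unoriented necklace underlying an oriented one. -/
def OrientedNecklace.toNecklace (v : OrientedNecklace γ V) : Necklace γ V :=
  Quotient.mk (OrientedNecklace.setoid γ V) v

instance mulAction : MulAction (PGL (ZMod p) V) (Necklace γ V) where
  smul g := Quotient.map (fun v => g • v) (by
    rintro v v' (rfl | rfl)
    · exact Or.inl rfl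
    · exact Or.inr (OrientedNecklace.smul_w g v))
  one_smul v := by
    induction v using Quotient.ind with
    | _ v => exact congrArg OrientedNecklace.toNecklace (one_smul _ v)
  mul_smul g g' v := by
    induction v using Quotient.ind with
    | _ v => exact congrArg OrientedNecklace.toNecklace (mul_smul g g' v)

/-- `A ↔ B ∈ v`: the pearls `A` and `B` are antipodal in the necklace `v`, that is `A = C_i` and
`B = C_j` with `i ≡ j + (p+1)/2 (mod p+1)` for a list `(C_0, …, C_p)` representing `v`. -/
def Antipodal (v : Necklace γ V) (A B : ℙ (ZMod p) V) : Prop :=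
  ∃ C : Labelling γ V, C.toOriented.toNecklace = v ∧
    ∃ i j : ZMod (p + 1), i = j + ((p + 1) / 2 : ℕ) ∧ C.pearl i = A ∧ C.pearl j = B

/-- The number of unordered pairs `{A, B}` antipodal both in `v` and in `w`. -/
def commonAntipodal (v w : Necklace γ V) : ℕ :=
  Set.ncard {s : Sym2 (ℙ (ZMod p) V) |
    ∃ A B, s = s(A, B) ∧ v.Antipodal A B ∧ w.Antipodal A B}

/-- The pairing on the free abelian group `⨁_v ℤ v` on the set of `γ`-necklaces, the bilinear
extension of `(v, w) ↦ commonAntipodal v w`. -/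
def pairing (γ : (GaloisField p 2)ˣ) (V : Type*) [AddCommGroup V] [Module (ZMod p) V] :
    LinearMap.BilinForm ℤ (Necklace γ V →₀ ℤ) :=
  Finsupp.linearCombination ℤ fun v : Necklace γ V =>
    Finsupp.linearCombination ℤ fun w : Necklace γ V => (commonAntipodal v w : ℤ)

theorem pairing_single (v w : Necklace γ V) :
    pairing γ V (Finsupp.single v 1) (Finsupp.single w 1) = commonAntipodal v w := by
  simp [pairing]

/-- The action of `PGL(V)` on the free abelian group on the necklaces, by permuting the basis. -/
def act (g : PGL (ZMod p) V) : (Necklace γ V →₀ ℤ) →ₗ[ℤ] (Necklace γ V →₀ ℤ) :=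
  Finsupp.lmapDomain ℤ ℤ fun v => g • v

/-- The group `E[p]` of `p`-torsion points of the elliptic curve `E` over the field `k`. -/
def Torsion {k : Type*} [Field k] [DecidableEq k] (E : WeierstrassCurve k) (p : ℕ) : Type _ :=
  AddSubgroup.torsionBy E.toAffine.Point (p : ℤ)

instance Torsion.addCommGroup {k : Type*} [Field k] [DecidableEq k] (E : WeierstrassCurve k)
    (p : ℕ) : AddCommGroup (Torsion E p) :=
  inferInstanceAs (AddCommGroup (AddSubgroup.torsionBy E.toAffine.Point (p : ℤ)))

instance Torsion.module {k : Type*} [Field k] [DecidableEq k] (E : WeierstrassCurve k)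
    (p : ℕ) : Module (ZMod p) (Torsion E p) :=
  AddSubgroup.torsionBy.zmodModule (A := E.toAffine.Point) (n := p)

end

end Necklace

/-!
A necklace supplies a basis of `V`, so if there are any necklaces at all then `V` is a plane over
`𝔽_p`, and nothing else about the `p`-torsion is needed. If `h` turns the necklace by one step, then
its antipodal pairs are the pairs of lines exchanged by the half turn `t = h ^ ((p + 1) / 2)`, an
involution of the projective line without fixed points. Half turns determine necklaces
(`halfTurn_injective`): representatives in `GL(V)` of two turns with the same half turn commute with
a representative of it, hence lie in the quadratic algebra that it generates; having the same
characteristic polynomial, they are conjugate there, and so the turns are equal or inverse to each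
other. As a projective transformation of a line is determined by its values at three points,
distinct necklaces have at most one common antipodal pair (`commonAntipodal_le_one`).

Let `A` be the incidence map from combinations of necklaces to functions on unordered pairs of
lines. The pairing is `⟨u, u'⟩ = ∑ s, A u s * A u' s`, so it is symmetric and positive, and it is
non-degenerate if `A` is injective. It suffices that `A` is injective modulo `p`
(`dvd_of_incidence_eq_zero`), since elements of the kernel can then be divided by `p` indefinitely.

In a coordinate of the projective line a half turn is `x ↦ b + D / (x - b)` with `D` a nonsquare.
So a necklace becomes a point `(b, D)`, and it has `{x, y}` as an antipodal pair if and only if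
`(x - b) (y - b) = D`. Let `u` be a function with values in `𝔽_p` on these points whose sums along
all the curves `(x - b) (y - b) = D` vanish. As `z ^ (p - 1)` is the indicator of `z ≠ 0`, the
polynomial `∑ u(b, D) ((x - b) (y - b) - D) ^ (p - 1)` in `x` and `y` takes the constant value
`∑ u(b, D)` on `𝔽_p × 𝔽_p`. Its degree in each variable is at most `p - 1`, so it is constant, and
comparing coefficients of `x ^ (p - 1) y ^ (p - 1)` shows that it is zero. As `x + y` and `x y` are
algebraically independent, all moments `∑ u(b, D) b ^ j c ^ k` with `c = b ^ 2 - D` and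
`j + k ≤ p - 1` vanish (`sum_mul_moment_eq_zero`). Finally, for each point there is a polynomial in
`b` and `c` of degree `p - 2` that vanishes at all other points but not at the given one
(`separating_eq_zero`, `separating_ne_zero`), so `u = 0`.
-/

/-! ### Moments of functions on the points inside a conic -/

namespace Necklace

open Finset

section Moments

variable {p : ℕ} [Fact p.Prime] {ι : Type*} [Fintype ι]

/-- If a combination of `n`-th powers of affine-linear forms in `x`, with `n < p`, is constant on
`𝔽_p`, then it is constant as a polynomial: its coefficients of positive degree vanish. The
binomial coefficients involved are invertible because `n < p`. -/
theorem sum_mul_pow_mul_pow_eq_zero {L : Type*} [Field L] [Algebra (ZMod p) L] {n : ℕ}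
    (hn : n < p) {u α β : ι → L} {c : L}
    (h : ∀ x : ZMod p, ∑ i, u i * (α i * algebraMap (ZMod p) L x + β i) ^ n = c)
    {j : ℕ} (hj : 0 < j) (hjn : j ≤ n) :
    ∑ i, u i * (α i ^ j * β i ^ (n - j)) = 0 := by
  have hp : p.Prime := Fact.out
  have : CharP L p := charP_of_injective_algebraMap (algebraMap (ZMod p) L).injective p
  let f : Polynomial L := (∑ k ∈ range (n + 1),
    Polynomial.monomial k ((n.choose k : L) * ∑ i, u i * (α i ^ k * β i ^ (n - k))))
      - Polynomial.C c
  have hdeg : f.natDegree ≤ n := by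
    rw [Polynomial.natDegree_sub_C]
    refine Polynomial.natDegree_sum_le_of_forall_le _ _ ?_
    intro k hk
    exact (Polynomial.natDegree_monomial_le _).trans (Nat.lt_succ_iff.1 (mem_range.1 hk))
  have hev : ∀ x : ZMod p, f.eval (algebraMap (ZMod p) L x) = 0 := by
    intro x
    simp only [f, Polynomial.eval_sub, Polynomial.eval_finsetSum, Polynomial.eval_monomial,
      Polynomial.eval_C]
    rw [← h x, sub_eq_zero]
    simp only [add_pow, mul_sum, sum_mul]
    rw [sum_comm]
    refine sum_congr rfl fun i _ => sum_congr rfl fun k _ => ?_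
    rw [mul_pow]
    ring
  have hf : f = 0 := Polynomial.eq_zero_of_natDegree_lt_card_of_eval_eq_zero f
    (algebraMap (ZMod p) L).injective hev (by rw [ZMod.card]; omega)
  have hcoeff := congrArg (fun q => Polynomial.coeff q j) hf
  simp only [f, Polynomial.coeff_sub, Polynomial.finsetSum_coeff, Polynomial.coeff_monomial,
    Polynomial.coeff_C, hj.ne', if_false, Polynomial.coeff_zero, sub_zero] at hcoeff
  rw [sum_ite_eq' (range (n + 1)) j, if_pos (mem_range.2 (by omega))] at hcoeff
  refine (mul_eq_zero.1 hcoeff).resolve_left fun h0 => ?_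
  rw [CharP.cast_eq_zero_iff L p] at h0
  have hdvd : p ∣ n.factorial := by
    rw [← Nat.choose_mul_factorial_mul_factorial hjn, mul_assoc]
    exact h0.mul_right _
  exact absurd (hp.dvd_factorial.1 hdvd) (by omega)

/-- If a combination of `n`-th powers of affine-linear forms in `x`, with `n < p`, vanishes on
`𝔽_p`, then all its coefficients vanish. -/
theorem sum_mul_pow_mul_pow_eq_zero' {L : Type*} [Field L] [Algebra (ZMod p) L] {n : ℕ}
    (hn : n < p) {u α β : ι → L}
    (h : ∀ x : ZMod p, ∑ i, u i * (α i * algebraMap (ZMod p) L x + β i) ^ n = 0)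
    {j : ℕ} (hjn : j ≤ n) :
    ∑ i, u i * (α i ^ j * β i ^ (n - j)) = 0 := by
  rcases Nat.eq_zero_or_pos j with rfl | hj
  · simpa using h 0
  · exact sum_mul_pow_mul_pow_eq_zero hn h hj hjn

/-- If a combination of `n`-th powers of affine-linear forms in `x`, with `n < p`, vanishes on
`𝔽_p`, then it vanishes on every extension field. -/
theorem sum_affine_pow_eq_zero {L : Type*} [Field L] [Algebra (ZMod p) L] {n : ℕ}
    (hn : n < p) {u α β : ι → L}
    (h : ∀ x : ZMod p, ∑ i, u i * (α i * algebraMap (ZMod p) L x + β i) ^ n = 0) (x : L) :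
    ∑ i, u i * (α i * x + β i) ^ n = 0 := by
  have : ∑ i, u i * (α i * x + β i) ^ n = ∑ k ∈ range (n + 1),
      x ^ k * n.choose k * ∑ i, u i * (α i ^ k * β i ^ (n - k)) := by
    simp only [add_pow, mul_sum]
    rw [sum_comm]
    refine sum_congr rfl fun k _ => sum_congr rfl fun i _ => ?_
    rw [mul_pow]
    ring
  rw [this]
  refine sum_eq_zero fun k hk => ?_
  rw [sum_mul_pow_mul_pow_eq_zero' hn h (Nat.lt_succ_iff.1 (mem_range.1 hk)), mul_zero]

theorem zmod_pow_sub_one_eq_ite (z : ZMod p) : z ^ (p - 1) = if z = 0 then 0 else 1 := by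
  have hp : p.Prime := Fact.out
  split_ifs with h
  · rw [h, zero_pow (Nat.sub_ne_zero_of_lt hp.one_lt)]
  · exact ZMod.pow_card_sub_one_eq_one h

/-- The function `u` on the points `(b, D)` of the plane sums to zero along each of the curves
`(x - b) (y - b) = D`. Then the sum of `u`, weighted by the `(p-1)`-st powers of the equations of
these curves, vanishes for all `x` and `y`. -/
theorem sum_mul_curve_pow_eq_zero {b D u : ι → ZMod p}
    (h : ∀ x y : ZMod p, ∑ i, (if (x - b i) * (y - b i) = D i then u i else 0) = 0)
    (x y : ZMod p) :
    ∑ i, u i * ((x - b i) * (y - b i) - D i) ^ (p - 1) = 0 := by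
  have hp : p.Prime := Fact.out
  have hlt : p - 1 < p := Nat.sub_lt hp.pos one_pos
  have hpos : 0 < p - 1 := Nat.sub_pos_of_lt hp.one_lt
  have h1 : ∀ x y : ZMod p,
      ∑ i, u i * ((x - b i) * (y - b i) - D i) ^ (p - 1) = ∑ i, u i := by
    intro x y
    rw [← sub_zero (∑ i, u i), ← h x y, ← sum_sub_distrib]
    refine sum_congr rfl fun i _ => ?_
    simp only [zmod_pow_sub_one_eq_ite, sub_eq_zero]
    split_ifs <;> simp
  -- The leading coefficient in `x`, then in `y`, of a constant polynomial vanishes.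
  have h2 : ∀ y : ZMod p, ∑ i, u i * (y - b i) ^ (p - 1) = 0 := by
    intro y
    have := sum_mul_pow_mul_pow_eq_zero (L := ZMod p) hlt (u := u) (α := fun i => y - b i)
      (β := fun i => -(b i * (y - b i)) - D i) (c := ∑ i, u i) (fun x => by
        rw [← h1 x y]
        refine sum_congr rfl fun i _ => ?_
        rw [Algebra.algebraMap_self, RingHom.id_apply]
        ring) hpos le_rfl
    simpa using this
  have h3 : ∑ i, u i = 0 := by
    have := sum_mul_pow_mul_pow_eq_zero (L := ZMod p) hlt (u := u) (α := fun _ => 1)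
      (β := fun i => -b i) (c := 0) (fun x => by
        rw [← h2 x]
        refine sum_congr rfl fun i _ => ?_
        rw [Algebra.algebraMap_self, RingHom.id_apply]
        ring) hpos le_rfl
    simpa using this
  rw [h1, h3]

/-- If `u` sums to zero along each of the curves `(x - b) (y - b) = D`, where `x, y ∈ 𝔽_p`, then
all its moments of degree at most `p - 1` in `b` and `c = b ^ 2 - D` vanish. In these coordinates
the curve is the line `c - (x + y) b + x y = 0`. Passing to `x` and `y` in the algebraic closure
makes `x + y` and `x y` independent, so that all lines over `𝔽_p` are reached. -/
theorem sum_mul_moment_eq_zero {b D u : ι → ZMod p}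
    (h : ∀ x y : ZMod p, ∑ i, (if (x - b i) * (y - b i) = D i then u i else 0) = 0)
    {j k : ℕ} (hjk : j + k ≤ p - 1) :
    ∑ i, u i * (b i ^ j * (b i ^ 2 - D i) ^ k) = 0 := by
  have hp : p.Prime := Fact.out
  have hlt : p - 1 < p := Nat.sub_lt hp.pos one_pos
  let L := AlgebraicClosure (ZMod p)
  let a := algebraMap (ZMod p) L
  have h1 : ∀ (x : L) (y : ZMod p),
      ∑ i, a (u i) * ((a y - a (b i)) * x + (-(a (b i) * (a y - a (b i))) - a (D i))) ^ (p - 1)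
        = 0 := by
    intro x y
    refine sum_affine_pow_eq_zero hlt (fun x => ?_) x
    have := congrArg a (sum_mul_curve_pow_eq_zero h x y)
    simp only [map_sum, map_mul, map_pow, map_sub, map_zero] at this
    rw [← this]
    exact sum_congr rfl fun i _ => by ring
  have h2 : ∀ x y : L,
      ∑ i, a (u i) * ((x - a (b i)) * y + (-(a (b i) * (x - a (b i))) - a (D i))) ^ (p - 1)
        = 0 := by
    intro x y
    refine sum_affine_pow_eq_zero hlt (fun y => ?_) y
    rw [← h1 x y]
    exact sum_congr rfl fun i _ => by ring
  have h3 : ∀ s t : ZMod p,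
      ∑ i, u i * (1 * t + (-(s * b i) + (b i ^ 2 - D i))) ^ (p - 1) = 0 := by
    intro s t
    -- `x` is a root of `X ^ 2 - s X + t`, and `y = s - x` is the other root.
    obtain ⟨x, hx⟩ := IsAlgClosed.exists_root
      (Polynomial.X ^ 2 - Polynomial.C (a s) * Polynomial.X + Polynomial.C (a t)) (by
        have : (Polynomial.X ^ 2 - Polynomial.C (a s) * Polynomial.X + Polynomial.C (a t)
          : Polynomial L).degree = 2 := by compute_degree!
        rw [this]; decide)
    have hx : x ^ 2 - a s * x + a t = 0 := by simpa using hx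
    have := h2 x (a s - x)
    apply a.injective
    rw [map_zero, ← this]
    simp only [map_sum, map_mul, map_pow, map_sub, map_add, map_neg, map_one]
    refine sum_congr rfl fun i _ => ?_
    congr 2
    linear_combination hx
  have h4 : ∀ s : ZMod p,
      ∑ i, u i * (-b i * s + (b i ^ 2 - D i)) ^ (j + k) = 0 := by
    intro s
    have := sum_mul_pow_mul_pow_eq_zero' (L := ZMod p) hlt (h3 s)
      (j := p - 1 - (j + k)) (Nat.sub_le _ _)
    rw [Nat.sub_sub_self hjk] at this
    rw [← this]
    refine sum_congr rfl fun i _ => ?_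
    rw [one_pow, one_mul]
    congr 2
    ring
  have h5 := sum_mul_pow_mul_pow_eq_zero' (L := ZMod p) (lt_of_le_of_lt hjk hlt) h4
    (Nat.le_add_right j k)
  rw [Nat.add_sub_cancel_left] at h5
  have h6 : (-1 : ZMod p) ^ j * ∑ i, u i * (b i ^ j * (b i ^ 2 - D i) ^ k) = 0 := by
    rw [← h5, mul_sum]
    refine sum_congr rfl fun i _ => ?_
    rw [neg_pow (b i)]
    ring
  exact (mul_eq_zero.1 h6).resolve_left (pow_ne_zero _ (neg_ne_zero.2 one_ne_zero))

theorem sum_mul_eval_eq_zero {b D u : ι → ZMod p}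
    (h : ∀ x y : ZMod p, ∑ i, (if (x - b i) * (y - b i) = D i then u i else 0) = 0)
    (f : MvPolynomial (Fin 2) (ZMod p)) (hf : f.totalDegree ≤ p - 1) :
    ∑ i, u i * f.eval ![b i, b i ^ 2 - D i] = 0 := by
  simp only [MvPolynomial.eval_eq', Fin.prod_univ_two, mul_sum]
  rw [sum_comm]
  refine sum_eq_zero fun d hd => ?_
  have hd' : d 0 + d 1 ≤ p - 1 := by
    refine le_trans ?_ ((MvPolynomial.le_totalDegree hd).trans hf)
    rw [Finsupp.sum_fintype _ _ (fun _ => rfl), Fin.sum_univ_two]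
  rw [← mul_zero (f.coeff d), ← sum_mul_moment_eq_zero h hd', mul_sum]
  refine sum_congr rfl fun i _ => ?_
  simp only [Matrix.cons_val_zero, Matrix.cons_val_one]
  ring

end Moments

end Necklace

/-! ### Separating the points inside a conic -/

namespace Necklace

open Finset

section Separation

variable {p : ℕ} [Fact p.Prime]

theorem zmod_pow_div_two_eq_neg_one {z : ZMod p} (hz : ¬ IsSquare z) : z ^ (p / 2) = -1 := by
  have h0 : z ≠ 0 := fun h => hz (h ▸ IsSquare.zero)
  exact (ZMod.pow_div_two_eq_neg_one_or_one p h0).resolve_left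
    fun h => hz ((ZMod.euler_criterion p h0).2 h)

/-- A polynomial in `(b, D)` vanishing at all points with `D` a nonsquare except `(b₀, D₀)`. Its
first factor `ℓ` is the polar line of `(b₀, D₀)` with respect to the conic `D = 0`, and the sum
comes from `(D ^ n - Y ^ n) / (D - Y)` with `Y = ℓ ^ 2 / (4 D₀)` and `n = (p - 1) / 2`. As `D` and,
for `ℓ ≠ 0`, also `Y` are nonsquares, `D ^ n = -1 = Y ^ n`, so the product vanishes unless
`D = Y`; the curve `D = Y` is a pair of conjugate lines, whose only rational point is
`(b₀, D₀)`. -/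
theorem separating_eq_zero (hp : p ≠ 2) {b₀ D₀ b D : ZMod p} (hD₀ : ¬ IsSquare D₀)
    (hD : ¬ IsSquare D) (hne : (b, D) ≠ (b₀, D₀)) {ℓ : ZMod p}
    (hℓ : ℓ = (b ^ 2 - D) - 2 * b₀ * b + (b₀ ^ 2 - D₀)) :
    ℓ * ∑ k ∈ range (p / 2), D ^ k * ((4 * D₀)⁻¹ * ℓ ^ 2) ^ (p / 2 - 1 - k) = 0 := by
  have h2 : (2 : ZMod p) ≠ 0 := Ring.two_ne_zero (by rwa [ZMod.ringChar_zmod_n])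
  have hD0 : D₀ ≠ 0 := fun h => hD₀ (h ▸ IsSquare.zero)
  have h4 : (4 : ZMod p) * D₀ ≠ 0 := by
    rw [show (4 : ZMod p) = 2 * 2 by norm_num]
    exact mul_ne_zero (mul_ne_zero h2 h2) hD0
  by_cases hℓ0 : ℓ = 0
  · rw [hℓ0, zero_mul]
  refine mul_eq_zero_of_right _ ?_
  set Y := (4 * D₀)⁻¹ * ℓ ^ 2 with hY
  have hYs : ¬ IsSquare Y := by
    rintro ⟨r, hr⟩
    have hYl : 4 * D₀ * Y = ℓ ^ 2 := by rw [hY, mul_inv_cancel_left₀ h4]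
    have hr0 : r ≠ 0 := by
      rintro rfl
      rw [hr, mul_zero, mul_zero] at hYl
      exact hℓ0 (pow_eq_zero_iff two_ne_zero |>.1 hYl.symm)
    refine hD₀ ⟨ℓ / (2 * r), ?_⟩
    field_simp
    rw [← hYl, hr]
    ring
  have hgeom := (Commute.all D Y).geom_sum₂_mul (p / 2)
  rw [zmod_pow_div_two_eq_neg_one hD, zmod_pow_div_two_eq_neg_one hYs, sub_self] at hgeom
  refine (mul_eq_zero.1 hgeom).resolve_right fun hDY => hne ?_
  have hquad : 4 * D₀ * D = ℓ ^ 2 := by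
    rw [sub_eq_zero.1 hDY, hY, mul_inv_cancel_left₀ h4]
  have hsq : ((b - b₀) ^ 2 - D + D₀) ^ 2 = D₀ * (2 * (b - b₀)) ^ 2 := by
    rw [hℓ] at hquad
    linear_combination -hquad
  have hb : b = b₀ := by
    by_contra hb
    have hb' : b - b₀ ≠ 0 := sub_ne_zero.2 hb
    refine hD₀ ⟨((b - b₀) ^ 2 - D + D₀) / (2 * (b - b₀)), ?_⟩
    rw [div_mul_div_comm, ← pow_two, ← pow_two, hsq,
      mul_div_cancel_right₀ _ (pow_ne_zero 2 (mul_ne_zero h2 hb'))]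
  rw [hb, sub_self] at hsq
  have : D₀ - D = 0 := pow_eq_zero_iff two_ne_zero |>.1 (by linear_combination hsq)
  rw [hb, sub_eq_zero.1 this]

/-- The polynomial of `separating_eq_zero` does not vanish at `(b₀, D₀)`: there `Y = D₀`, so the sum
has `(p - 1) / 2` equal terms, a number prime to `p`. -/
theorem separating_ne_zero (hp : p ≠ 2) {b₀ D₀ : ZMod p} (hD₀ : D₀ ≠ 0) {ℓ : ZMod p}
    (hℓ : ℓ = (b₀ ^ 2 - D₀) - 2 * b₀ * b₀ + (b₀ ^ 2 - D₀)) :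
    ℓ * ∑ k ∈ range (p / 2), D₀ ^ k * ((4 * D₀)⁻¹ * ℓ ^ 2) ^ (p / 2 - 1 - k) ≠ 0 := by
  have hpr : p.Prime := Fact.out
  have h2 : (2 : ZMod p) ≠ 0 := Ring.two_ne_zero (by rwa [ZMod.ringChar_zmod_n])
  have hℓ' : ℓ = -(2 * D₀) := by rw [hℓ]; ring
  have hY : (4 * D₀)⁻¹ * ℓ ^ 2 = D₀ := by
    have h4 : (4 : ZMod p) * D₀ ≠ 0 := by
      rw [show (4 : ZMod p) = 2 * 2 by norm_num]
      exact mul_ne_zero (mul_ne_zero h2 h2) hD₀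
    rw [hℓ', inv_mul_eq_iff_eq_mul₀ h4]
    ring
  have hterm : ∀ k ∈ range (p / 2), D₀ ^ k * D₀ ^ (p / 2 - 1 - k) = D₀ ^ (p / 2 - 1) := by
    intro k hk
    rw [← pow_add]
    congr 1
    have := mem_range.1 hk
    omega
  rw [hY, sum_congr rfl hterm, sum_const, card_range, nsmul_eq_mul]
  refine mul_ne_zero ?_ (mul_ne_zero ?_ (pow_ne_zero _ hD₀))
  · rw [hℓ']
    exact neg_ne_zero.2 (mul_ne_zero h2 hD₀)
  · rw [Ne, ZMod.natCast_eq_zero_iff]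
    have := hpr.two_le
    intro hdvd
    have := Nat.le_of_dvd (by omega) hdvd
    omega

/-- The curves `(x - b) (y - b) = D`, for `x, y ∈ 𝔽_p`, separate functions with values in `𝔽_p` on
the points `(b, D)` with `D` a nonsquare. -/
theorem eq_zero_of_sum_on_curves_eq_zero (hp : p ≠ 2) {ι : Type*} [Fintype ι]
    {b D u : ι → ZMod p} (hD : ∀ i, ¬ IsSquare (D i))
    (hinj : Function.Injective fun i => (b i, D i))
    (h : ∀ x y : ZMod p, ∑ i, (if (x - b i) * (y - b i) = D i then u i else 0) = 0) (i₀ : ι) :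
    u i₀ = 0 := by
  have hpr : p.Prime := Fact.out
  let ℓ : MvPolynomial (Fin 2) (ZMod p) :=
    MvPolynomial.X 1 - MvPolynomial.C (2 * b i₀) * MvPolynomial.X 0
      + MvPolynomial.C (b i₀ ^ 2 - D i₀)
  let Δ : MvPolynomial (Fin 2) (ZMod p) := MvPolynomial.X 0 ^ 2 - MvPolynomial.X 1
  let f : MvPolynomial (Fin 2) (ZMod p) := ℓ * ∑ k ∈ range (p / 2),
    Δ ^ k * (MvPolynomial.C (4 * D i₀)⁻¹ * ℓ ^ 2) ^ (p / 2 - 1 - k)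
  have hℓ : ℓ.totalDegree ≤ 1 := by
    refine (MvPolynomial.totalDegree_add _ _).trans (max_le ?_ ?_)
    · refine (MvPolynomial.totalDegree_sub _ _).trans (max_le (by simp) ?_)
      refine (MvPolynomial.totalDegree_mul _ _).trans ?_
      rw [MvPolynomial.totalDegree_C, MvPolynomial.totalDegree_X]
    · rw [MvPolynomial.totalDegree_C]
      exact zero_le_one
  have hℓ2 : (MvPolynomial.C (4 * D i₀)⁻¹ * ℓ ^ 2).totalDegree ≤ 2 := by
    refine (MvPolynomial.totalDegree_mul _ _).trans ?_
    have := MvPolynomial.totalDegree_pow ℓ 2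
    rw [MvPolynomial.totalDegree_C]
    omega
  have hΔ : Δ.totalDegree ≤ 2 := by
    refine (MvPolynomial.totalDegree_sub _ _).trans (max_le ?_ (by simp))
    exact (MvPolynomial.totalDegree_pow _ _).trans (by simp)
  have hf : f.totalDegree ≤ p - 1 := by
    refine (MvPolynomial.totalDegree_mul _ _).trans ?_
    have : (∑ k ∈ range (p / 2), Δ ^ k *
        (MvPolynomial.C (4 * D i₀)⁻¹ * ℓ ^ 2) ^ (p / 2 - 1 - k)).totalDegree ≤ p - 2 := by
      refine MvPolynomial.totalDegree_finsetSum_le fun k hk => ?_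
      refine (MvPolynomial.totalDegree_mul _ _).trans ?_
      have h1 := (MvPolynomial.totalDegree_pow Δ k).trans (Nat.mul_le_mul_left k hΔ)
      have h2 := (MvPolynomial.totalDegree_pow (MvPolynomial.C (4 * D i₀)⁻¹ * ℓ ^ 2)
        (p / 2 - 1 - k)).trans (Nat.mul_le_mul_left _ hℓ2)
      have := mem_range.1 hk
      omega
    have := hpr.two_le
    omega
  have heval : ∀ i, f.eval ![b i, b i ^ 2 - D i] =
      ((b i ^ 2 - D i) - 2 * b i₀ * b i + (b i₀ ^ 2 - D i₀)) * ∑ k ∈ range (p / 2), D i ^ k *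
        ((4 * D i₀)⁻¹ * ((b i ^ 2 - D i) - 2 * b i₀ * b i + (b i₀ ^ 2 - D i₀)) ^ 2)
          ^ (p / 2 - 1 - k) := by
    intro i
    simp [f, ℓ, Δ]
  have hsum := sum_mul_eval_eq_zero h f hf
  rw [sum_eq_single i₀ (fun i _ hi => by
      rw [heval, separating_eq_zero hp (hD i₀) (hD i) (hinj.ne hi) rfl, mul_zero])
    (fun hi => absurd (mem_univ _) hi), heval] at hsum
  exact (mul_eq_zero.1 hsum).resolve_right
    (separating_ne_zero hp (fun h0 => hD i₀ (by rw [h0]; exact IsSquare.zero)) rfl)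

end Separation

end Necklace

/-! ### Projective transformations of a line -/

namespace Necklace

section PGL

variable {K : Type*} [Field K] {V : Type*} [AddCommGroup V] [Module K V]

theorem PGL.mk_smul_mk (g : LinearMap.GeneralLinearGroup K V) {v : V} (hv : v ≠ 0)
    (hgv : (g : V →ₗ[K] V) v ≠ 0) :
    (QuotientGroup.mk g : PGL K V) • Projectivization.mk K v hv = Projectivization.mk K _ hgv :=
  rfl

theorem GL.apply_ne_zero (g : LinearMap.GeneralLinearGroup K V) {v : V} (hv : v ≠ 0) :
    (g : V →ₗ[K] V) v ≠ 0 :=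
  (smul_ne_zero_iff_ne g).2 hv

theorem PGL.mk_eq_mk_of_smul_eq {g g' : LinearMap.GeneralLinearGroup K V} {c : K} (hc : c ≠ 0)
    (h : (g : V →ₗ[K] V) = c • (g' : V →ₗ[K] V)) :
    (QuotientGroup.mk g : PGL K V) = QuotientGroup.mk g' := by
  refine (QuotientGroup.eq.2 (show g'⁻¹ * g ∈ scalars K V from ⟨Units.mk0 c hc, ?_⟩)).symm
  rw [eq_inv_mul_iff_mul_eq]
  ext v
  rw [h]
  simp [Module.algebraMap_end_apply]

theorem PGL.exists_smul_eq_of_mk_eq_mk {g g' : LinearMap.GeneralLinearGroup K V}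
    (h : (QuotientGroup.mk g : PGL K V) = QuotientGroup.mk g') :
    ∃ c : K, c ≠ 0 ∧ (g : V →ₗ[K] V) = c • (g' : V →ₗ[K] V) := by
  obtain ⟨c, hc⟩ := QuotientGroup.eq.1 h.symm
  refine ⟨c, c.ne_zero, ?_⟩
  rw [eq_inv_mul_iff_mul_eq] at hc
  ext v
  rw [← hc]
  simp [Module.algebraMap_end_apply]

/-- A projective transformation of a line with three fixed points is the identity. -/
theorem PGL.eq_one_of_three_fixed (e : Module.Basis (Fin 2) K V) {h : PGL K V} {A B C : ℙ K V}
    (hAB : A ≠ B) (hAC : A ≠ C) (hBC : B ≠ C) (hA : h • A = A) (hB : h • B = B)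
    (hC : h • C = C) : h = 1 := by
  obtain ⟨g, rfl⟩ := QuotientGroup.mk_surjective h
  have hlin := Projectivization.linearIndependent_pair_iff_ne.2 hAB
  have key : ∀ X : ℙ K V, (QuotientGroup.mk g : PGL K V) • X = X →
      ∃ a : K, (g : V →ₗ[K] V) X.rep = a • X.rep := by
    intro X hX
    rw [← X.mk_rep, PGL.mk_smul_mk g X.rep_nonzero (GL.apply_ne_zero g X.rep_nonzero),
      Projectivization.mk_eq_mk_iff'] at hX
    obtain ⟨a, ha⟩ := hX
    exact ⟨a, ha.symm⟩
  obtain ⟨a, ha⟩ := key A hA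
  obtain ⟨b, hb⟩ := key B hB
  obtain ⟨c, hc⟩ := key C hC
  have hfin : Module.finrank K V = 2 := by simpa using Module.finrank_eq_card_basis e
  let f := basisOfLinearIndependentOfCardEqFinrank hlin (by simp [hfin])
  have hf0 : f 0 = A.rep := by simp [f]
  have hf1 : f 1 = B.rep := by simp [f]
  obtain ⟨s, t, hst⟩ : ∃ s t : K, C.rep = s • A.rep + t • B.rep := by
    refine ⟨f.repr C.rep 0, f.repr C.rep 1, ?_⟩
    conv_lhs => rw [← f.sum_repr C.rep]
    rw [Fin.sum_univ_two, hf0, hf1]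
  have hs : s ≠ 0 := by
    rintro rfl
    refine hBC ?_
    rw [← B.mk_rep, ← C.mk_rep, eq_comm, Projectivization.mk_eq_mk_iff']
    exact ⟨t, by rw [hst, zero_smul, zero_add]⟩
  have ht : t ≠ 0 := by
    rintro rfl
    refine hAC ?_
    rw [← A.mk_rep, ← C.mk_rep, eq_comm, Projectivization.mk_eq_mk_iff']
    exact ⟨s, by rw [hst, zero_smul, add_zero]⟩
  have hcomb : (s * (a - c)) • A.rep + (t * (b - c)) • B.rep = 0 := by
    rw [hst, map_add, map_smul, map_smul, ha, hb] at hc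
    rw [← sub_eq_zero] at hc
    rw [← hc]
    module
  obtain ⟨h1, h2⟩ := LinearIndependent.pair_iff.1 hlin _ _ hcomb
  have hac : a = c := sub_eq_zero.1 ((mul_eq_zero.1 h1).resolve_left hs)
  have hbc : b = c := sub_eq_zero.1 ((mul_eq_zero.1 h2).resolve_left ht)
  have hc0 : c ≠ 0 := by
    rintro rfl
    exact GL.apply_ne_zero g C.rep_nonzero (by rw [hc, zero_smul])
  refine PGL.mk_eq_mk_of_smul_eq (g' := 1) hc0 (f.ext fun i => ?_)
  fin_cases i
  · simpa [hf0, hac] using ha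
  · simpa [hf1, hbc] using hb

theorem PGL.eq_of_three_points (e : Module.Basis (Fin 2) K V) {h h' : PGL K V} {A B C : ℙ K V}
    (hAB : A ≠ B) (hAC : A ≠ C) (hBC : B ≠ C) (hA : h • A = h' • A) (hB : h • B = h' • B)
    (hC : h • C = h' • C) : h = h' := by
  rw [← inv_mul_eq_one]
  refine PGL.eq_one_of_three_fixed e hAB hAC hBC ?_ ?_ ?_ <;>
  · rw [mul_smul, inv_smul_eq_iff]
    exact Eq.symm ‹_›

theorem affinePoint_ne_zero (e : Module.Basis (Fin 2) K V) (x : K) : x • e 0 + e 1 ≠ 0 := by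
  intro h
  have := LinearIndependent.pair_iff.1
    (show LinearIndependent K ![e 0, e 1] by
      convert e.linearIndependent using 1
      ext i; fin_cases i <;> rfl) x 1 (by rwa [one_smul])
  exact one_ne_zero this.2

/-- The point with coordinate `x` of the projective line of a plane with basis `e`. -/
noncomputable def affinePoint (e : Module.Basis (Fin 2) K V) (x : K) : ℙ K V :=
  Projectivization.mk K (x • e 0 + e 1) (affinePoint_ne_zero e x)

/-- The projective transformation `h` is, in the coordinate given by the basis `e`, the involution
`x ↦ b + D / (x - b)`. -/
def IsStdInvolution (e : Module.Basis (Fin 2) K V) (h : PGL K V) (b D : K) : Prop :=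
  ∃ g : LinearMap.GeneralLinearGroup K V, QuotientGroup.mk g = h ∧
    LinearMap.toMatrix e e (g : V →ₗ[K] V) = !![b, D - b ^ 2; 1, -b]

theorem IsStdInvolution.unique {e : Module.Basis (Fin 2) K V} {h h' : PGL K V} {b D : K}
    (hh : IsStdInvolution e h b D) (hh' : IsStdInvolution e h' b D) : h = h' := by
  obtain ⟨g, rfl, hg⟩ := hh
  obtain ⟨g', rfl, hg'⟩ := hh'
  exact congrArg _ (Units.ext ((LinearMap.toMatrix e e).injective (hg.trans hg'.symm)))

theorem apply_basis_of_toMatrix_eq {e : Module.Basis (Fin 2) K V} {f : V →ₗ[K] V}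
    {M : Matrix (Fin 2) (Fin 2) K} (h : LinearMap.toMatrix e e f = M) (j : Fin 2) :
    f (e j) = M 0 j • e 0 + M 1 j • e 1 := by
  rw [← h, ← Fin.sum_univ_two fun i => LinearMap.toMatrix e e f i j • e i]
  simp only [LinearMap.toMatrix_apply]
  exact (e.sum_repr _).symm

theorem pair_coords_eq (e : Module.Basis (Fin 2) K V) {a b c d : K}
    (h : a • e 0 + b • e 1 = c • e 0 + d • e 1) : a = c ∧ b = d := by
  have h0 := congrArg (fun v => e.repr v 0) h
  have h1 := congrArg (fun v => e.repr v 1) h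
  simpa [Finsupp.single_apply] using And.intro h0 h1

theorem IsStdInvolution.smul_affinePoint_eq_iff {e : Module.Basis (Fin 2) K V} {h : PGL K V}
    {b D : K} (hh : IsStdInvolution e h b D) (x y : K) :
    h • affinePoint e y = affinePoint e x ↔ (x - b) * (y - b) = D := by
  obtain ⟨g, rfl, hg⟩ := hh
  have h0 : (g : V →ₗ[K] V) (e 0) = b • e 0 + (1 : K) • e 1 := apply_basis_of_toMatrix_eq hg 0
  have h1 : (g : V →ₗ[K] V) (e 1) = (D - b ^ 2) • e 0 + (-b) • e 1 :=
    apply_basis_of_toMatrix_eq hg 1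
  have hgy : (g : V →ₗ[K] V) (y • e 0 + e 1) = (y * b + D - b ^ 2) • e 0 + (y - b) • e 1 := by
    rw [map_add, map_smul, h0, h1]
    module
  rw [affinePoint, affinePoint,
    PGL.mk_smul_mk g _ (GL.apply_ne_zero g (affinePoint_ne_zero e y)),
    Projectivization.mk_eq_mk_iff']
  constructor
  · rintro ⟨a, ha⟩
    rw [hgy, smul_add, smul_smul] at ha
    obtain ⟨h2, h3⟩ := pair_coords_eq e ha
    rw [h3] at h2
    linear_combination h2
  · intro hxy
    refine ⟨y - b, ?_⟩
    rw [hgy, smul_add, smul_smul]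
    congr 2
    linear_combination hxy

/-- An involution of the projective line without fixed points is `x ↦ b + D / (x - b)` with `D` a
nonsquare: the point at infinity is not fixed, so the lower left matrix entry can be scaled to
`1`, and the square being scalar forces the trace to vanish. -/
theorem exists_isStdInvolution (e : Module.Basis (Fin 2) K V) {h : PGL K V} (hh : h * h = 1)
    (hfix : ∀ A : ℙ K V, h • A ≠ A) :
    ∃ b D : K, ¬ IsSquare D ∧ IsStdInvolution e h b D := by
  obtain ⟨g, rfl⟩ := QuotientGroup.mk_surjective h
  set M := LinearMap.toMatrix e e (g : V →ₗ[K] V) with hM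
  have h0 : (g : V →ₗ[K] V) (e 0) = M 0 0 • e 0 + M 1 0 • e 1 := apply_basis_of_toMatrix_eq rfl 0
  have h10 : M 1 0 ≠ 0 := by
    intro h10
    rw [h10, zero_smul, add_zero] at h0
    refine hfix (Projectivization.mk K (e 0) (e.ne_zero 0)) ?_
    rw [PGL.mk_smul_mk g _ (GL.apply_ne_zero g (e.ne_zero 0)), Projectivization.mk_eq_mk_iff']
    exact ⟨M 0 0, h0.symm⟩
  obtain ⟨δ, -, hδ⟩ := PGL.exists_smul_eq_of_mk_eq_mk (g := g * g) (g' := 1) hh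
  have hMM : M * M = δ • (1 : Matrix (Fin 2) (Fin 2) K) := by
    rw [hM, ← LinearMap.toMatrix_mul, ← LinearMap.toMatrix_one e, ← map_smul]
    exact congrArg _ hδ
  have htr : M 1 1 = -M 0 0 := by
    have := congrFun (congrFun hMM 1) 0
    simp only [Matrix.mul_apply, Fin.sum_univ_two, Matrix.smul_apply, Matrix.one_apply,
      Fin.one_eq_zero_iff, if_false, smul_zero, OfNat.ofNat_ne_one] at this
    have : M 1 0 * (M 1 1 + M 0 0) = 0 := by linear_combination this
    exact eq_neg_of_add_eq_zero_left ((mul_eq_zero.1 this).resolve_left h10)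
  let c := M 1 0
  let b := M 0 0 / c
  let D := b ^ 2 + M 0 1 / c
  let g' : LinearMap.GeneralLinearGroup K V :=
    Units.map (algebraMap K (Module.End K V)).toMonoidHom (Units.mk0 c⁻¹ (inv_ne_zero h10)) * g
  have hg' : (g' : V →ₗ[K] V) = c⁻¹ • (g : V →ₗ[K] V) := by
    ext v
    simp [g', Module.algebraMap_end_apply]
  have hstd : IsStdInvolution e (QuotientGroup.mk g : PGL K V) b D := by
    refine ⟨g', PGL.mk_eq_mk_of_smul_eq (inv_ne_zero h10) hg', ?_⟩
    rw [hg', map_smul, ← hM]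
    ext i j
    fin_cases i <;> fin_cases j <;> simp [b, D, c, htr, h10] <;> field_simp
  refine ⟨b, D, ?_, hstd⟩
  rintro ⟨r, hr⟩
  exact hfix _ ((hstd.smul_affinePoint_eq_iff (b + r) (b + r)).2 (by rw [hr]; ring))

end PGL

end Necklace

/-! ### The antipodal involution of a necklace -/

namespace Necklace

section Centralizer

variable {K : Type*} [Field K]

/-- Two matrices commuting with the same traceless nonscalar matrix, and having the same trace and
determinant, are equal or adjugate to each other. -/
theorem eq_or_eq_adjugate_of_commute (h2 : (2 : K) ≠ 0) {b D : K}
    {M M' : Matrix (Fin 2) (Fin 2) K}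
    (hM : M * !![b, D - b ^ 2; 1, -b] = !![b, D - b ^ 2; 1, -b] * M)
    (hM' : M' * !![b, D - b ^ 2; 1, -b] = !![b, D - b ^ 2; 1, -b] * M') (hD : D ≠ 0)
    (htr : M.trace = M'.trace) (hdet : M.det = M'.det) : M' = M ∨ M' = M.adjugate := by
  have key : ∀ M : Matrix (Fin 2) (Fin 2) K,
      M * !![b, D - b ^ 2; 1, -b] = !![b, D - b ^ 2; 1, -b] * M →
      M 0 1 = (D - b ^ 2) * M 1 0 ∧ M 0 0 = M 1 1 + 2 * b * M 1 0 := by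
    intro M hM
    have h00 := congrFun (congrFun hM 0) 0
    have h10 := congrFun (congrFun hM 1) 0
    simp [Matrix.mul_apply, Fin.sum_univ_two] at h00 h10
    exact ⟨by linear_combination h00, by linear_combination -h10⟩
  obtain ⟨h01, h00⟩ := key M hM
  obtain ⟨h01', h00'⟩ := key M' hM'
  rw [Matrix.trace_fin_two, Matrix.trace_fin_two] at htr
  rw [Matrix.det_fin_two, Matrix.det_fin_two] at hdet
  have hsum : M 1 1 + b * M 1 0 = M' 1 1 + b * M' 1 0 := by
    refine mul_left_cancel₀ h2 ?_
    linear_combination htr - h00 + h00'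
  have hsq : M' 1 0 ^ 2 = M 1 0 ^ 2 := by
    refine mul_left_cancel₀ hD ?_
    rw [h01, h01', h00, h00'] at hdet
    linear_combination hdet - (M 1 1 + b * M 1 0 + (M' 1 1 + b * M' 1 0)) * hsum
  rcases sq_eq_sq_iff_eq_or_eq_neg.1 hsq with h10 | h10
  · left
    have h11 : M' 1 1 = M 1 1 := by rw [h10] at hsum; linear_combination -hsum
    ext i j
    fin_cases i <;> fin_cases j
    · simp [h00, h00', h10, h11]
    · simp [h01, h01', h10]
    · simp [h10]
    · simp [h11]
  · right
    have h11 : M' 1 1 = M 0 0 := by rw [h10] at hsum; linear_combination -hsum - h00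
    rw [Matrix.adjugate_fin_two]
    ext i j
    fin_cases i <;> fin_cases j
    · simp [h00', h10, h11, h00]
    · simp [h01, h01', h10]
    · simp [h10]
    · simp [h11]

end Centralizer

variable {p : ℕ} [Fact p.Prime] {γ : (GaloisField p 2)ˣ} {V : Type*} [AddCommGroup V]
  [Module (ZMod p) V]

theorem charpoly_toMatrix_eq {f f' : V →ₗ[ZMod p] V} {e b b' : Module.Basis (Fin 2) (ZMod p) V}
    (h : (LinearMap.toMatrix b b f).charpoly = (LinearMap.toMatrix b' b' f').charpoly) :
    (LinearMap.toMatrix e e f).charpoly = (LinearMap.toMatrix e e f').charpoly := by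
  have := Module.Finite.of_basis e
  have := Module.Free.of_basis e
  simpa only [LinearMap.charpoly_toMatrix] using h

/-- Two elements of `𝒞_γ` with a common power that is an involution without fixed points are equal
or inverse to each other. Representatives with the same characteristic polynomial commute with a
representative of this involution, so they are equal or adjugate to each other. -/
theorem eq_or_eq_inv_of_pow_eq (hp : p ≠ 2) (e : Module.Basis (Fin 2) (ZMod p) V)
    {h h' : PGL (ZMod p) V} (hh : h ∈ conjClass γ V) (hh' : h' ∈ conjClass γ V) {m : ℕ}
    (hpow : h ^ m = h' ^ m) (hinv : h ^ m * h ^ m = 1) (hfix : ∀ A : ℙ (ZMod p) V, h ^ m • A ≠ A) :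
    h' = h ∨ h' = h⁻¹ := by
  have h2 : (2 : ZMod p) ≠ 0 := Ring.two_ne_zero (by rwa [ZMod.ringChar_zmod_n])
  obtain ⟨b, D, hD, g₀, hg₀, hN⟩ := exists_isStdInvolution e hinv hfix
  have hcomm : ∀ g : LinearMap.GeneralLinearGroup (ZMod p) V,
      (QuotientGroup.mk g : PGL (ZMod p) V) ^ m = h ^ m →
      LinearMap.toMatrix e e (g : V →ₗ[ZMod p] V) * !![b, D - b ^ 2; 1, -b]
        = !![b, D - b ^ 2; 1, -b] * LinearMap.toMatrix e e (g : V →ₗ[ZMod p] V) := by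
    intro g hg
    obtain ⟨c, -, hcg⟩ := PGL.exists_smul_eq_of_mk_eq_mk (g := g₀) (g' := g ^ m)
      (hg₀.trans hg.symm)
    have hN' : LinearMap.toMatrix e e ((g ^ m : LinearMap.GeneralLinearGroup (ZMod p) V) :
        V →ₗ[ZMod p] V) = LinearMap.toMatrix e e (g : V →ₗ[ZMod p] V) ^ m := by
      rw [Units.val_pow_eq_pow_val]
      exact map_pow (LinearMap.toMatrixAlgEquiv e) _ _
    rw [← hN, hcg, map_smul, hN', Matrix.mul_smul, Matrix.smul_mul, ← pow_succ, ← pow_succ']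
  obtain ⟨g, rfl, f, hf⟩ := hh
  obtain ⟨g', rfl, f', hf'⟩ := hh'
  have hchar := charpoly_toMatrix_eq (e := e) (hf.trans hf'.symm)
  set M := LinearMap.toMatrix e e (g : V →ₗ[ZMod p] V) with hM
  set M' := LinearMap.toMatrix e e (g' : V →ₗ[ZMod p] V) with hM'
  have htr : M.trace = M'.trace := by
    rw [Matrix.trace_eq_neg_charpoly_coeff, Matrix.trace_eq_neg_charpoly_coeff, hchar]
  have hdet : M.det = M'.det := by
    rw [Matrix.det_eq_sign_charpoly_coeff, Matrix.det_eq_sign_charpoly_coeff, hchar]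
  have hD0 : D ≠ 0 := by
    rintro rfl
    exact hD IsSquare.zero
  rcases eq_or_eq_adjugate_of_commute h2 (hcomm g rfl) (hcomm g' hpow.symm) hD0 htr hdet
    with hMM | hMM
  · left
    exact congrArg _ (Units.ext ((LinearMap.toMatrix e e).injective hMM))
  · right
    have hprod : LinearMap.toMatrix e e ((g' * g : LinearMap.GeneralLinearGroup (ZMod p) V) :
        V →ₗ[ZMod p] V) = LinearMap.toMatrix e e (M.det • (1 : V →ₗ[ZMod p] V)) := by
      rw [Units.val_mul, LinearMap.toMatrix_mul, map_smul, LinearMap.toMatrix_one,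
        show LinearMap.toMatrix e e (g' : V →ₗ[ZMod p] V) = M.adjugate from hMM, Matrix.adjugate_mul]
    have hdet0 : M.det ≠ 0 := by
      have hone : M * LinearMap.toMatrix e e
          ((g⁻¹ : LinearMap.GeneralLinearGroup (ZMod p) V) : V →ₗ[ZMod p] V) = 1 := by
        rw [hM, ← LinearMap.toMatrix_mul, ← Units.val_mul, mul_inv_cancel, Units.val_one,
          LinearMap.toMatrix_one]
      exact ((Matrix.isUnit_iff_isUnit_det M).1 (IsUnit.of_mul_eq_one _ hone)).ne_zero
    refine eq_inv_of_mul_eq_one_left ?_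
    exact PGL.mk_eq_mk_of_smul_eq (g' := 1) hdet0 ((LinearMap.toMatrix e e).injective hprod)

theorem exists_basis_of_labelling (C : Labelling γ V) :
    Nonempty (Module.Basis (Fin 2) (ZMod p) V) := by
  obtain ⟨h, ⟨g, -, b, -⟩, -⟩ := C.exists_turn
  exact ⟨b⟩

namespace Labelling

theorem pow_smul_pearl {C : Labelling γ V} {h : PGL (ZMod p) V}
    (hC : ∀ i, h • C.pearl i = C.pearl (i + 1)) (n : ℕ) (i : ZMod (p + 1)) :
    h ^ n • C.pearl i = C.pearl (i + n) := by
  induction n with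
  | zero => simp
  | succ n ih => rw [pow_succ', mul_smul, ih, hC, Nat.cast_succ, add_assoc]

/-- `PGL(V)` acts faithfully on the lines of a plane, as there are at least three of them. -/
theorem eq_of_smul_pearl_eq (C : Labelling γ V) {h h' : PGL (ZMod p) V}
    (hC : ∀ i, h • C.pearl i = h' • C.pearl i) : h = h' := by
  obtain ⟨e⟩ := exists_basis_of_labelling C
  have hp := (Fact.out : p.Prime).two_le
  have h01 : ((0 : ℕ) : ZMod (p + 1)) ≠ (1 : ℕ) := by
    rw [Ne, ZMod.natCast_eq_natCast_iff', Nat.mod_eq_of_lt, Nat.mod_eq_of_lt] <;> omega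
  have h02 : ((0 : ℕ) : ZMod (p + 1)) ≠ (2 : ℕ) := by
    rw [Ne, ZMod.natCast_eq_natCast_iff', Nat.mod_eq_of_lt, Nat.mod_eq_of_lt] <;> omega
  have h12 : ((1 : ℕ) : ZMod (p + 1)) ≠ (2 : ℕ) := by
    rw [Ne, ZMod.natCast_eq_natCast_iff', Nat.mod_eq_of_lt, Nat.mod_eq_of_lt] <;> omega
  exact PGL.eq_of_three_points e (C.bijective.1.ne h01) (C.bijective.1.ne h02)
    (C.bijective.1.ne h12) (hC _) (hC _) (hC _)

theorem toOriented_eq_of_smul {C C' : Labelling γ V} {h : PGL (ZMod p) V}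
    (hC : ∀ i, h • C.pearl i = C.pearl (i + 1)) (hC' : ∀ i, h • C'.pearl i = C'.pearl (i + 1)) :
    C.toOriented = C'.toOriented := by
  obtain ⟨k, hk⟩ := C.bijective.2 (C'.pearl 0)
  refine Quotient.sound ⟨k, fun i => ?_⟩
  obtain ⟨n, rfl⟩ := ZMod.natCast_zmod_surjective i
  have h1 := pow_smul_pearl hC' n 0
  rw [zero_add, ← hk, pow_smul_pearl hC] at h1
  rw [← h1, add_comm]

theorem half_add_half (hp : p ≠ 2) :
    (((p + 1) / 2 : ℕ) : ZMod (p + 1)) + ((p + 1) / 2 : ℕ) = 0 := by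
  have hodd := (Fact.out : p.Prime).eq_two_or_odd.resolve_left hp
  rw [← Nat.cast_add, show (p + 1) / 2 + (p + 1) / 2 = p + 1 by omega, ZMod.natCast_self]

theorem half_ne_zero : (((p + 1) / 2 : ℕ) : ZMod (p + 1)) ≠ 0 := by
  have hp := (Fact.out : p.Prime).two_le
  rw [Ne, ZMod.natCast_eq_zero_iff]
  intro h
  have := Nat.le_of_dvd (by omega) h
  omega

/-- Antipodality in a necklace can be read off from any list that represents it. -/
theorem antipodal_iff (hp : p ≠ 2) (C : Labelling γ V) (A B : ℙ (ZMod p) V) :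
    C.toOriented.toNecklace.Antipodal A B ↔
      ∃ j, C.pearl (j + ((p + 1) / 2 : ℕ)) = A ∧ C.pearl j = B := by
  constructor
  · rintro ⟨C', hC', i, j, rfl, rfl, rfl⟩
    rcases (Quotient.exact hC' : C.toOriented = C'.toOriented ∨ C.toOriented = C'.toOriented.w)
      with h | h
    · obtain ⟨k, hk⟩ := (Quotient.exact h.symm :
        ∃ k : ZMod (p + 1), ∀ i, C.pearl i = C'.pearl (i + k)) |> fun h => h
      refine ⟨j - k, ?_, ?_⟩ <;> rw [hk] <;> congr 1 <;> ring
    · obtain ⟨k, hk⟩ : ∃ k : ZMod (p + 1), ∀ i, C.pearl i = C'.pearl (-1 - (i + k)) :=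
        Quotient.exact h.symm
      refine ⟨-1 - k - j, ?_, ?_⟩ <;> rw [hk] <;> congr 1
      · linear_combination -half_add_half hp
      · ring
  · rintro ⟨j, rfl, rfl⟩
    exact ⟨C, rfl, _, j, rfl, rfl, rfl⟩

theorem antipodal_iff_smul (hp : p ≠ 2) {C : Labelling γ V} {h : PGL (ZMod p) V}
    (hC : ∀ i, h • C.pearl i = C.pearl (i + 1)) (A B : ℙ (ZMod p) V) :
    C.toOriented.toNecklace.Antipodal A B ↔ h ^ ((p + 1) / 2) • B = A := by
  rw [antipodal_iff hp]
  constructor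
  · rintro ⟨j, rfl, rfl⟩
    exact pow_smul_pearl hC _ _
  · rintro rfl
    obtain ⟨j, rfl⟩ := C.bijective.2 B
    exact ⟨j, (pow_smul_pearl hC _ _).symm, rfl⟩

theorem half_turn_mul_self (hp : p ≠ 2) {C : Labelling γ V} {h : PGL (ZMod p) V}
    (hC : ∀ i, h • C.pearl i = C.pearl (i + 1)) : h ^ ((p + 1) / 2) * h ^ ((p + 1) / 2) = 1 :=
  C.eq_of_smul_pearl_eq fun i => by
    rw [mul_smul, pow_smul_pearl hC, pow_smul_pearl hC, add_assoc, half_add_half hp, add_zero,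
      one_smul]

theorem half_turn_smul_ne {C : Labelling γ V} {h : PGL (ZMod p) V}
    (hC : ∀ i, h • C.pearl i = C.pearl (i + 1)) (A : ℙ (ZMod p) V) :
    h ^ ((p + 1) / 2) • A ≠ A := by
  obtain ⟨j, rfl⟩ := C.bijective.2 A
  rw [pow_smul_pearl hC]
  exact C.bijective.1.ne (by rw [Ne, add_eq_left]; exact half_ne_zero)

end Labelling

theorem exists_labelling (v : Necklace γ V) : ∃ C : Labelling γ V, C.toOriented.toNecklace = v := by
  induction v using Quotient.ind with
  | _ v =>
    induction v using Quotient.ind with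
    | _ C => exact ⟨C, rfl⟩

/-- The antipodal map of a necklace is the half turn `h ^ ((p + 1) / 2)`. -/
theorem exists_halfTurn (hp : p ≠ 2) (v : Necklace γ V) :
    ∃ t : PGL (ZMod p) V, t * t = 1 ∧ (∀ A : ℙ (ZMod p) V, t • A ≠ A) ∧
      ∀ A B, v.Antipodal A B ↔ t • B = A := by
  obtain ⟨C, rfl⟩ := exists_labelling v
  obtain ⟨h, -, hC⟩ := C.exists_turn
  exact ⟨_, Labelling.half_turn_mul_self hp hC, Labelling.half_turn_smul_ne hC,
    Labelling.antipodal_iff_smul hp hC⟩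

/-- The involution of the projective line exchanging the antipodal pearls of a necklace. -/
noncomputable def halfTurn (hp : p ≠ 2) (v : Necklace γ V) : PGL (ZMod p) V :=
  (exists_halfTurn hp v).choose

theorem halfTurn_mul_self (hp : p ≠ 2) (v : Necklace γ V) : v.halfTurn hp * v.halfTurn hp = 1 :=
  (exists_halfTurn hp v).choose_spec.1

theorem halfTurn_smul_ne (hp : p ≠ 2) (v : Necklace γ V) (A : ℙ (ZMod p) V) :
    v.halfTurn hp • A ≠ A :=
  (exists_halfTurn hp v).choose_spec.2.1 A

theorem antipodal_iff (hp : p ≠ 2) (v : Necklace γ V) (A B : ℙ (ZMod p) V) :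
    v.Antipodal A B ↔ v.halfTurn hp • B = A :=
  (exists_halfTurn hp v).choose_spec.2.2 A B

/-- A necklace is determined by its half turn. -/
theorem halfTurn_injective (hp : p ≠ 2) :
    Function.Injective (halfTurn hp : Necklace γ V → PGL (ZMod p) V) := by
  intro v w hvw
  obtain ⟨C, rfl⟩ := exists_labelling v
  obtain ⟨C', rfl⟩ := exists_labelling w
  obtain ⟨h, hh, hC⟩ := C.exists_turn
  obtain ⟨h', hh', hC'⟩ := C'.exists_turn
  obtain ⟨e⟩ := exists_basis_of_labelling C
  have hpow : h ^ ((p + 1) / 2) = h' ^ ((p + 1) / 2) := by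
    refine C.eq_of_smul_pearl_eq fun i => ?_
    rw [← Labelling.antipodal_iff_smul hp hC, antipodal_iff hp, hvw, ← antipodal_iff hp,
      Labelling.antipodal_iff_smul hp hC']
  rcases eq_or_eq_inv_of_pow_eq hp e hh hh' hpow (Labelling.half_turn_mul_self hp hC)
    (Labelling.half_turn_smul_ne hC) with rfl | rfl
  · exact congrArg _ (Labelling.toOriented_eq_of_smul hC hC')
  · have hrev : ∀ i, h⁻¹ • C.reverse.pearl i = C.reverse.pearl (i + 1) := by
      intro i
      rw [inv_smul_eq_iff]
      change C.pearl (-1 - i) = h • C.pearl (-1 - (i + 1))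
      rw [hC]
      exact congrArg C.pearl (by ring)
    have := Labelling.toOriented_eq_of_smul hrev hC'
    exact Quotient.sound (Or.inr this.symm)

end Necklace

/-! ### The pairing on necklaces -/

namespace Necklace

variable {p : ℕ} [Fact p.Prime] {γ : (GaloisField p 2)ˣ} {V : Type*} [AddCommGroup V]
  [Module (ZMod p) V]

theorem Antipodal.symm (hp : p ≠ 2) {v : Necklace γ V} {A B : ℙ (ZMod p) V}
    (h : v.Antipodal A B) : v.Antipodal B A := by
  rw [antipodal_iff hp] at h ⊢
  rw [← h, ← mul_smul, halfTurn_mul_self, one_smul]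

/-- The set of unordered pairs of antipodal pearls of a necklace. -/
def antipodalPairs (v : Necklace γ V) : Set (Sym2 (ℙ (ZMod p) V)) :=
  {s | ∃ A B, s = s(A, B) ∧ v.Antipodal A B}

theorem mk_mem_antipodalPairs (hp : p ≠ 2) {v : Necklace γ V} {A B : ℙ (ZMod p) V} :
    s(A, B) ∈ v.antipodalPairs ↔ v.Antipodal A B := by
  constructor
  · rintro ⟨A', B', hs, h⟩
    rcases Sym2.eq_iff.1 hs with ⟨rfl, rfl⟩ | ⟨rfl, rfl⟩
    · exact h
    · exact h.symm hp
  · exact fun h => ⟨A, B, rfl, h⟩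

theorem commonAntipodal_eq_ncard_inter (hp : p ≠ 2) (v w : Necklace γ V) :
    commonAntipodal v w = (v.antipodalPairs ∩ w.antipodalPairs).ncard := by
  refine congrArg Set.ncard (Set.ext fun s => ?_)
  constructor
  · rintro ⟨A, B, rfl, hv, hw⟩
    exact ⟨⟨A, B, rfl, hv⟩, ⟨A, B, rfl, hw⟩⟩
  · rintro ⟨⟨A, B, rfl, hv⟩, hw⟩
    exact ⟨A, B, rfl, hv, (mk_mem_antipodalPairs hp).1 hw⟩

theorem exists_basis (v : Necklace γ V) : Nonempty (Module.Basis (Fin 2) (ZMod p) V) := by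
  obtain ⟨C, -⟩ := exists_labelling v
  exact exists_basis_of_labelling C

theorem finite_lines (v : Necklace γ V) : Finite (ℙ (ZMod p) V) := by
  obtain ⟨C, -⟩ := exists_labelling v
  exact Finite.of_surjective _ C.bijective.2

theorem antipodalPairs_smul (g : PGL (ZMod p) V) (v : Necklace γ V) :
    (g • v).antipodalPairs = Sym2.map (g • ·) '' v.antipodalPairs := by
  have key : ∀ (g : PGL (ZMod p) V) (v : Necklace γ V) (A B : ℙ (ZMod p) V),
      v.Antipodal A B → (g • v).Antipodal (g • A) (g • B) := by
    rintro g _ A B ⟨C, rfl, i, j, hij, rfl, rfl⟩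
    exact ⟨g • C, rfl, i, j, hij, rfl, rfl⟩
  ext s
  constructor
  · rintro ⟨A, B, rfl, h⟩
    have h' := key g⁻¹ _ _ _ h
    rw [inv_smul_smul] at h'
    exact ⟨_, ⟨_, _, rfl, h'⟩, by simp⟩
  · rintro ⟨_, ⟨A, B, rfl, h⟩, rfl⟩
    exact ⟨_, _, by simp, key g _ _ _ h⟩

theorem commonAntipodal_smul (hp : p ≠ 2) (g : PGL (ZMod p) V) (v w : Necklace γ V) :
    commonAntipodal (g • v) (g • w) = commonAntipodal v w := by
  have hinj : Function.Injective (Sym2.map fun A : ℙ (ZMod p) V => g • A) :=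
    Sym2.map.injective (MulAction.injective g)
  rw [commonAntipodal_eq_ncard_inter hp, commonAntipodal_eq_ncard_inter hp, antipodalPairs_smul,
    antipodalPairs_smul, ← Set.image_inter hinj, Set.ncard_image_of_injective _ hinj]

theorem commonAntipodal_self (hp : p ≠ 2) (v : Necklace γ V) :
    commonAntipodal v v = (p + 1) / 2 := by
  obtain ⟨C, rfl⟩ := exists_labelling v
  have hodd := (Fact.out : p.Prime).eq_two_or_odd.resolve_left hp
  have hcast : ∀ {i j : ℕ}, i < p + 1 → j < p + 1 → (i : ZMod (p + 1)) = j → i = j := by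
    intro i j hi hj h
    rwa [ZMod.natCast_eq_natCast_iff', Nat.mod_eq_of_lt hi, Nat.mod_eq_of_lt hj] at h
  rw [commonAntipodal_eq_ncard_inter hp, Set.inter_self]
  have himage : C.toOriented.toNecklace.antipodalPairs =
      (fun i : ℕ => s(C.pearl (i + ((p + 1) / 2 : ℕ)), C.pearl i)) ''
        (Finset.range ((p + 1) / 2) : Set ℕ) := by
    ext s
    constructor
    · rintro ⟨A, B, rfl, h⟩
      obtain ⟨j, rfl, rfl⟩ := (Labelling.antipodal_iff hp C A B).1 h
      have hj := ZMod.val_lt j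
      by_cases hlt : j.val < (p + 1) / 2
      · exact ⟨j.val, by simpa using hlt, by simp⟩
      · refine ⟨j.val - (p + 1) / 2, by simp; omega, ?_⟩
        have h1 : ((j.val - (p + 1) / 2 : ℕ) : ZMod (p + 1)) = j + ((p + 1) / 2 : ℕ) := by
          rw [Nat.cast_sub (by omega), ZMod.natCast_zmod_val]
          linear_combination -Labelling.half_add_half hp
        simp only [h1]
        rw [add_assoc, Labelling.half_add_half hp, add_zero, Sym2.eq_swap]
    · rintro ⟨i, -, rfl⟩
      exact ⟨_, _, rfl, (Labelling.antipodal_iff hp C _ _).2 ⟨i, rfl, rfl⟩⟩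
  rw [himage, Set.InjOn.ncard_image, Set.ncard_coe_finset, Finset.card_range]
  intro i hi j hj hij
  have hi := Finset.mem_range.1 hi
  have hj := Finset.mem_range.1 hj
  rcases Sym2.eq_iff.1 hij with ⟨-, h⟩ | ⟨-, h⟩
  · exact hcast (by omega) (by omega) (C.bijective.1 h)
  · have h' := C.bijective.1 h
    rw [← Nat.cast_add] at h'
    have := hcast (by omega) (by omega) h'
    omega

/-- Two necklaces with two common pairs of antipodal pearls have half turns that agree at four
points. -/
theorem commonAntipodal_le_one (hp : p ≠ 2) {v w : Necklace γ V} (hvw : v ≠ w) :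
    commonAntipodal v w ≤ 1 := by
  obtain ⟨e⟩ := exists_basis v
  have := finite_lines v
  have : Finite (Sym2 (ℙ (ZMod p) V)) := Quot.finite _
  rw [commonAntipodal_eq_ncard_inter hp, Set.ncard_le_one]
  rintro _ ⟨⟨A, B, rfl, hv⟩, hw⟩ _ ⟨⟨A', B', rfl, hv'⟩, hw'⟩
  rw [mk_mem_antipodalPairs hp] at hw hw'
  by_contra hne
  have hvs := hv.symm hp
  have hws := hw.symm hp
  rw [antipodal_iff hp] at hv hw hv' hw' hvs hws
  have hBB' : B ≠ B' := by
    rintro rfl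
    exact hne (by rw [← hv, ← hv'])
  have hAB' : A ≠ B' := by
    rintro rfl
    exact hne (by rw [← hv', hvs, Sym2.eq_swap])
  have hAB : A ≠ B := fun h => halfTurn_smul_ne hp v B (hv.trans h)
  exact hvw (halfTurn_injective hp (PGL.eq_of_three_points e hAB hAB' hBB'
    (hvs.trans hws.symm) (hv.trans hw.symm) (hv'.trans hw'.symm)))

open scoped Classical in
/-- The incidence map from combinations of necklaces to functions on unordered pairs of lines,
which sends a necklace to the indicator function of its pairs of antipodal pearls. -/
noncomputable def incidence (γ : (GaloisField p 2)ˣ) (V : Type*) [AddCommGroup V]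
    [Module (ZMod p) V] : (Necklace γ V →₀ ℤ) →ₗ[ℤ] (Sym2 (ℙ (ZMod p) V) → ℤ) :=
  Finsupp.linearCombination ℤ fun v : Necklace γ V => fun s =>
    if s ∈ v.antipodalPairs then 1 else 0

open scoped Classical in
theorem incidence_single (v : Necklace γ V) (a : ℤ) (s : Sym2 (ℙ (ZMod p) V)) :
    incidence γ V (Finsupp.single v a) s = if s ∈ v.antipodalPairs then a else 0 := by
  simp [incidence]

theorem pairing_single_single (v w : Necklace γ V) (a b : ℤ) :
    pairing γ V (Finsupp.single v a) (Finsupp.single w b) = a * (b * commonAntipodal v w) := by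
  simp [pairing]

theorem pairing_eq_sum_incidence (hp : p ≠ 2) [Fintype (Sym2 (ℙ (ZMod p) V))]
    (u u' : Necklace γ V →₀ ℤ) :
    pairing γ V u u' = ∑ s, incidence γ V u s * incidence γ V u' s := by
  classical
  induction u using Finsupp.induction_linear with
  | zero => simp
  | add f g hf hg => simp [hf, hg, add_mul, Finset.sum_add_distrib]
  | single v a =>
    induction u' using Finsupp.induction_linear with
    | zero => simp
    | add f g hf hg => simp [hf, hg, mul_add, Finset.sum_add_distrib]
    | single w b =>
      rw [pairing_single_single, commonAntipodal_eq_ncard_inter hp, Set.ncard_eq_toFinset_card',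
        Finset.card_eq_sum_ones, Nat.cast_sum, Finset.mul_sum, Finset.mul_sum]
      rw [← Finset.sum_subset (Finset.subset_univ (v.antipodalPairs ∩ w.antipodalPairs).toFinset)]
      · refine Finset.sum_congr rfl fun s hs => ?_
        rw [Set.mem_toFinset] at hs
        rw [incidence_single, incidence_single, if_pos hs.1, if_pos hs.2]
        simp
      · intro s _ hs
        rw [Set.mem_toFinset, Set.mem_inter_iff, not_and_or] at hs
        rw [incidence_single, incidence_single]
        rcases hs with hs | hs <;> simp [hs]

theorem dvd_of_incidence_eq_zero (hp : p ≠ 2) {u : Necklace γ V →₀ ℤ}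
    (hu : incidence γ V u = 0) (v : Necklace γ V) : (p : ℤ) ∣ u v := by
  classical
  obtain ⟨e⟩ := exists_basis v
  choose b D hD hstd using fun v : Necklace γ V =>
    exists_isStdInvolution e (halfTurn_mul_self hp v) (halfTurn_smul_ne hp v)
  have hinj : Function.Injective fun v : Necklace γ V => (b v, D v) := by
    intro v w hvw
    obtain ⟨hb, hd⟩ := Prod.mk.inj hvw
    refine halfTurn_injective hp ((hstd v).unique ?_)
    rw [hb, hd]
    exact hstd w
  have : Finite (Necklace γ V) := Finite.of_injective _ hinj
  have := Fintype.ofFinite (Necklace γ V)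
  have hsum : ∀ x y : ZMod p,
      ∑ w, (if (x - b w) * (y - b w) = D w then ((u w : ℤ) : ZMod p) else 0) = 0 := by
    intro x y
    have := congrArg (Int.cast : ℤ → ZMod p) (congrFun hu s(affinePoint e x, affinePoint e y))
    rw [incidence, Finsupp.linearCombination_apply, Finsupp.sum_fintype _ _ (by simp),
      Finset.sum_apply, Int.cast_sum, Pi.zero_apply, Int.cast_zero] at this
    refine Eq.trans (Finset.sum_congr rfl fun w _ => ?_) this
    simp only [Pi.smul_apply, mk_mem_antipodalPairs hp, antipodal_iff hp,
      (hstd w).smul_affinePoint_eq_iff]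
    split_ifs <;> simp
  rw [← ZMod.intCast_zmod_eq_zero_iff_dvd]
  exact eq_zero_of_sum_on_curves_eq_zero hp hD hinj hsum v

/-- The incidence map is injective: an element of its kernel is divisible by `p`, and its quotient
by `p` is again in the kernel. -/
theorem incidence_injective (hp : p ≠ 2) : Function.Injective (incidence γ V) := by
  have hpr : p.Prime := Fact.out
  have key : ∀ (n : ℕ) (u : Necklace γ V →₀ ℤ), incidence γ V u = 0 →
      ∀ v, (p : ℤ) ^ n ∣ u v := by
    intro n
    induction n with
    | zero => simp
    | succ n ih =>
      intro u hu v
      let u' : Necklace γ V →₀ ℤ := u.mapRange (· / (p : ℤ)) (Int.zero_ediv _)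
      have huu' : u = (p : ℤ) • u' := by
        ext w
        simp [u', Int.mul_ediv_cancel' (dvd_of_incidence_eq_zero hp hu w)]
      have hu' : incidence γ V u' = 0 := by
        rw [huu', map_smul] at hu
        exact (smul_eq_zero.1 hu).resolve_left (by exact_mod_cast hpr.ne_zero)
      rw [huu', pow_succ']
      exact mul_dvd_mul_left _ (ih u' hu' v)
  rw [injective_iff_map_eq_zero]
  intro u hu
  ext v
  refine Int.eq_zero_of_abs_lt_dvd (key (u v).natAbs u hu v) ?_
  rw [Int.abs_eq_natAbs]
  exact_mod_cast Nat.lt_pow_self hpr.one_lt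

theorem pairing_isSymm : (pairing γ V).IsSymm := by
  refine ⟨fun u u' => ?_⟩
  induction u using Finsupp.induction_linear with
  | zero => simp
  | add f g hf hg => simp_all
  | single v a =>
    induction u' using Finsupp.induction_linear with
    | zero => simp
    | add f g hf hg => simp_all
    | single w b =>
      have : commonAntipodal v w = commonAntipodal w v := by
        simp only [commonAntipodal, and_comm]
      simp only [pairing_single_single, this]
      ring

theorem pairing_act (hp : p ≠ 2) (g : PGL (ZMod p) V) (u u' : Necklace γ V →₀ ℤ) :
    pairing γ V (act g u) (act g u') = pairing γ V u u' := by
  induction u using Finsupp.induction_linear with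
  | zero => simp
  | add f g hf hg => simp_all
  | single v a =>
    induction u' using Finsupp.induction_linear with
    | zero => simp
    | add f g hf hg => simp_all
    | single w b =>
      simp only [act, Finsupp.lmapDomain_apply, Finsupp.mapDomain_single, pairing_single_single,
        commonAntipodal_smul hp]

theorem pairing_self_nonneg (hp : p ≠ 2) (u : Necklace γ V →₀ ℤ) : 0 ≤ pairing γ V u u := by
  rcases isEmpty_or_nonempty (Necklace γ V) with h | ⟨⟨v⟩⟩
  · rw [Subsingleton.elim u 0, map_zero]
  · have := finite_lines v
    have : Finite (Sym2 (ℙ (ZMod p) V)) := Quot.finite _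
    have := Fintype.ofFinite (Sym2 (ℙ (ZMod p) V))
    rw [pairing_eq_sum_incidence hp]
    exact Finset.sum_nonneg fun s _ => mul_self_nonneg _

theorem eq_zero_of_pairing_self_eq_zero (hp : p ≠ 2) {u : Necklace γ V →₀ ℤ}
    (hu : pairing γ V u u = 0) : u = 0 := by
  rcases isEmpty_or_nonempty (Necklace γ V) with h | ⟨⟨v⟩⟩
  · exact Subsingleton.elim u 0
  · have := finite_lines v
    have : Finite (Sym2 (ℙ (ZMod p) V)) := Quot.finite _
    have := Fintype.ofFinite (Sym2 (ℙ (ZMod p) V))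
    rw [pairing_eq_sum_incidence hp,
      Finset.sum_eq_zero_iff_of_nonneg fun s _ => mul_self_nonneg _] at hu
    refine incidence_injective hp ?_
    rw [map_zero]
    ext s
    exact mul_self_eq_zero.1 (hu s (Finset.mem_univ s))

end Necklace

theorem mainTheorem2 (p : ℕ) [Fact p.Prime] (hp : p ≠ 2)
    (γ : (GaloisField p 2)ˣ) (hγ : ∀ x : (GaloisField p 2)ˣ, x ∈ Subgroup.zpowers γ)
    {k : Type*} [Field k] [IsAlgClosed k] [DecidableEq k] (hpk : (p : k) ≠ 0)
    (E : WeierstrassCurve k) [E.IsElliptic] :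
    (Necklace.pairing γ (Necklace.Torsion E p)).IsSymm ∧
    (∀ u, 0 ≤ Necklace.pairing γ (Necklace.Torsion E p) u u) ∧
    (Necklace.pairing γ (Necklace.Torsion E p)).Nondegenerate ∧
    (∀ (g : Necklace.PGL (ZMod p) (Necklace.Torsion E p)) (u u' : _ →₀ ℤ),
      Necklace.pairing γ (Necklace.Torsion E p) (Necklace.act g u) (Necklace.act g u')
        = Necklace.pairing γ (Necklace.Torsion E p) u u') ∧
    (∀ v : Necklace γ (Necklace.Torsion E p),
      (Necklace.pairing γ (Necklace.Torsion E p)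
        (Finsupp.single v 1) (Finsupp.single v 1) : ℚ) = ((p : ℚ) + 1) / 2) ∧
    (∀ v w : Necklace γ (Necklace.Torsion E p), v ≠ w →
      Necklace.pairing γ (Necklace.Torsion E p) (Finsupp.single v 1) (Finsupp.single w 1)
        ∈ ({0, 1} : Set ℤ)) := by
  refine ⟨Necklace.pairing_isSymm, Necklace.pairing_self_nonneg hp, ⟨?_, ?_⟩,
    Necklace.pairing_act hp, fun v => ?_, fun v w hvw => ?_⟩
  · exact fun u hu => Necklace.eq_zero_of_pairing_self_eq_zero hp (hu u)
  · exact fun u hu => Necklace.eq_zero_of_pairing_self_eq_zero hp (hu u)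
  · have hodd := (Fact.out : p.Prime).eq_two_or_odd.resolve_left hp
    have h2 : 2 ∣ p + 1 := by omega
    rw [Necklace.pairing_single, Necklace.commonAntipodal_self hp, Int.cast_natCast,
      Nat.cast_div h2 two_ne_zero]
    push_cast
    rfl
  · rw [Necklace.pairing_single]
    have := Necklace.commonAntipodal_le_one hp hvw
    interval_cases Necklace.commonAntipodal v w <;> simp
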